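/- Let $(S,\mathcal S)$ be a measurable space and let $\nu$ be a complex measure on $S$ with $\sigma$-finite total variation, $\nu(dx)=\xi(x)\,m(dx)$ with $m$ a $\sigma$-finite positive measure and $\xi:S\to\mathbb C$ measurable, so that $|\nu|(dx)=|\xi(x)|\,m(dx)$. Let $w:S\times S\to\{u\in\mathbb C:|u|\le 1\}$ be measurable and symmetric. *Definitions.* For $n\ge1$ let $$\omega_n(x_1,\dots,x_n)=\prod_{1\le i<j\le n}w(x_i,x_j),\qquad \omega^T_n(x_1,\dots,x_n)=\sum_{G}\ \prod_{\{i,j\}\in E(G)}\bigl[w(x_i,x_j)-1\bigr],$$ where $G$ runs over the connected graphs with vertex set $\{1,\dots,n\}$ (so $\omega^T_1=1$). The absolute pinned cluster expansion is the function $S\to[0,\infty]$ $$|\boldsymbol\Gamma|(\nu)(x)=1+\sum_{n\ge1}\frac1{n!}\int_{S^n}\bigl|\omega^T_{n+1}(x,x_1,\dots,x_n)\bigr|\,|\nu|(dx_1)\cdots|\nu|(dx_n).$$ Let $$\varphi_n(x;x_1,\dots,x_n)=\prod_{1\le i\le n}|w(x,x_i)-1|\prod_{1\le i<j\le n}|w(x_i,x_j)|\quad(\varphi_0=1),$$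 $$B_n(x_0;x_1,\dots,x_n)=\sum_{\tau}\prod_{i=0}^n\varphi_{s_i}\bigl(x_i;x_{(i,1)},\dots,x_{(i,s_i)}\bigr),$$ where $\tau$ runs over the trees with vertex set $\{0,1,\dots,n\}$ rooted at $0$ and $(i,1),\dots,(i,s_i)$ are the children of $i$ in $\tau$. The tree sum is the function $S\to[0,\infty]$ $$\boldsymbol{\mathcal B}(\nu)(x)=1+\sum_{n\ge1}\frac1{n!}\int_{S^n}B_n(x;x_1,\dots,x_n)\,|\nu|(dx_1)\cdots|\nu|(dx_n).$$ For measurable $\Lambda\subset S$ with $|\nu|(\Lambda)<\infty$ let $$\Xi_\Lambda(\nu)=1+\sum_{n\ge1}\frac1{n!}\int_{\Lambda^n}\omega_n(x_1,\dots,x_n)\,\nu(dx_1)\cdots\nu(dx_n).$$ As a formal power series, $\ln\Xi_\Lambda(z\nu)=\sum_{n\ge0}c_nz^n$ is the formal logarithm of the series in $z$ of $\Xi_\Lambda(z\nu)$. As a number, $\ln\Xi_\Lambda(\nu)$ is the value at $t=1$ of the continuous logarithm of $t\mapsto\Xi_\Lambda(t\nu)$, $t\in[0,1]$, that vanishes at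 $t=0$; it is defined if such a continuous logarithm exists. *Claim.* 1. For every $x\in S$, $\;|\boldsymbol\Gamma|(\nu)(x)\le\boldsymbol{\mathcal B}(\nu)(x)$, both term by term, that is, for every $n\ge0$ $$\frac1{n!}\int_{S^n}|\omega^T_{n+1}(x,x_1,\dots,x_n)|\,|\nu|(dx_1)\cdots|\nu|(dx_n)\le\frac1{n!}\int_{S^n}B_n(x;x_1,\dots,x_n)\,|\nu|(dx_1)\cdots|\nu|(dx_n),$$ and as an inequality in $[0,\infty]$. 2. For every measurable $\Lambda\subset S$ with $|\nu|(\Lambda)<\infty$, $\;|\ln\Xi_\Lambda(\nu)|\le\int_\Lambda|\boldsymbol\Gamma|(\nu)(x)\,|\nu|(dx)$, in the following senses. - Term by term: $c_0=0$ and, for every $n\ge0$, $$|c_{n+1}|\le\int_\Lambda\frac1{n!}\int_{S^n}|\omega^T_{n+1}(x,x_1,\dots,x_n)|\,|\nu|(dx_1)\cdots|\nu|(dx_n)\,|\nu|(dx).$$ - As numbers: whenever $\ln\Xi_\Lambda(\nu)$ is defined, the inequality holds in $[0,\infty]$. - If $\int_\Lambda|\boldsymbol\Gamma|(\nu)\,d|\nu|<\infty$,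 then $\ln\Xi_\Lambda(\nu)$ is defined and equals the absolutely convergent sum $\sum_{n}c_n$. -/

import Mathlib

/-!
The complex, possibly infinite measure `ν` on `S` is given as `ν(dx) = ξ(x) m(dx)` with `m` a
σ-finite positive measure and `ξ : S → ℂ` a measurable density; its total variation is
`|ν|(dx) = |ξ(x)| m(dx)`.  Taking `m = |ν|` and `|ξ| = 1` (polar decomposition) one obtains every
complex measure whose total variation is finite or σ-finite.  For `z ∈ ℂ` the measure `zν` has
density `z ξ`.
-/

namespace ClusterExp

open MeasureTheory
open scoped ENNReal Nat

noncomputable section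

variable {S : Type*}

/-- `ω_n(x_1,…,x_n) = ∏_{i<j} w(x_i,x_j)`. -/
def omega (w : S → S → ℂ) {n : ℕ} (x : Fin n → S) : ℂ :=
  ∏ p : Fin n × Fin n with p.1 < p.2, w (x p.1) (x p.2)

open Classical in
/-- The truncated function `ω^T_n(x_1,…,x_n)`: the sum over the connected graphs `G` on the
vertices `1,…,n` of `∏_{{i,j} ∈ E(G)} (w(x_i,x_j) - 1)`; an edge is listed as a pair `i < j`.
For `n = 1` the only graph has no edge and the value is `1`. -/
def omegaT (w : S → S → ℂ) {n : ℕ} (x : Fin n → S) : ℂ :=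
  ∑ G : SimpleGraph (Fin n) with G.Connected,
    ∏ p : Fin n × Fin n with p.1 < p.2 ∧ G.Adj p.1 p.2, (w (x p.1) (x p.2) - 1)

/-- The vertex weight `φ_s(x; (y_i)_{i ∈ C})`, with `s = |C|`:
`∏_{i ∈ C} |w(x,y_i) - 1| · ∏_{i<j in C} |w(y_i,y_j)|`. -/
def phi (w : S → S → ℂ) (x : S) {ι : Type*} [LinearOrder ι] (C : Finset ι) (y : ι → S) : ℝ≥0∞ :=
  (∏ i ∈ C, ‖w x (y i) - 1‖ₑ) * ∏ p ∈ C ×ˢ C with p.1 < p.2, ‖w (y p.1) (y p.2)‖ₑ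

open Classical in
/-- The children of the vertex `i` in a tree on `{0,…,n}` rooted at `0`: the neighbours of `i`
that lie one generation further from the root. -/
def children {n : ℕ} (τ : SimpleGraph (Fin (n + 1))) (i : Fin (n + 1)) : Finset (Fin (n + 1)) :=
  {j | τ.Adj i j ∧ τ.dist 0 j = τ.dist 0 i + 1}

open Classical in
/-- `B_n(x_0; x_1,…,x_n)`: the sum over the trees `τ` on `{0,…,n}` rooted at `0` of the product
over the vertices `i` of `φ_{s_i}(x_i; x_{(i,1)},…,x_{(i,s_i)})`, where `(i,1),…,(i,s_i)` are the
children of `i` in `τ`. -/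
def treeWeight (w : S → S → ℂ) {n : ℕ} (x : Fin (n + 1) → S) : ℝ≥0∞ :=
  ∑ τ : SimpleGraph (Fin (n + 1)) with τ.IsTree, ∏ i, phi w (x i) (children τ i) x

variable [MeasurableSpace S]

/-- The total variation `|ν|` of `ν(dx) = ξ(x) m(dx)`. -/
def absMeasure (m : Measure S) (ξ : S → ℂ) : Measure S :=
  m.withDensity fun x => ‖ξ x‖ₑ

/-- The `n`-th term `(1/n!) ∫_{S^n} |ω^T_{n+1}(x,x_1,…,x_n)| |ν|(dx_1)⋯|ν|(dx_n)` of the absolute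
pinned cluster expansion. -/
def absGammaTerm (w : S → S → ℂ) (m : Measure S) (ξ : S → ℂ) (n : ℕ) (x : S) : ℝ≥0∞ :=
  (n ! : ℝ≥0∞)⁻¹ * ∫⁻ y : Fin n → S, ‖omegaT w (Fin.cons x y : Fin (n + 1) → S)‖ₑ
    ∂(Measure.pi fun _ => absMeasure m ξ)

/-- The absolute pinned cluster expansion `|Γ|(ν)(x)`, with values in `[0,∞]`. -/
def absGamma (w : S → S → ℂ) (m : Measure S) (ξ : S → ℂ) (x : S) : ℝ≥0∞ :=
  1 + ∑' n : ℕ, absGammaTerm w m ξ (n + 1) x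

/-- The `n`-th term `(1/n!) ∫_{S^n} B_n(x;x_1,…,x_n) |ν|(dx_1)⋯|ν|(dx_n)` of the tree sum. -/
def treeSumTerm (w : S → S → ℂ) (m : Measure S) (ξ : S → ℂ) (n : ℕ) (x : S) : ℝ≥0∞ :=
  (n ! : ℝ≥0∞)⁻¹ * ∫⁻ y : Fin n → S, treeWeight w (Fin.cons x y : Fin (n + 1) → S)
    ∂(Measure.pi fun _ => absMeasure m ξ)

/-- The tree sum `𝓑(ν)(x)`, with values in `[0,∞]`. -/
def treeSum (w : S → S → ℂ) (m : Measure S) (ξ : S → ℂ) (x : S) : ℝ≥0∞ :=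
  1 + ∑' n : ℕ, treeSumTerm w m ξ (n + 1) x

/-- The `n`-th term `(1/n!) ∫_{Λ^n} ω_n(x_1,…,x_n) ν(dx_1)⋯ν(dx_n)` of the partition function
(for `n = 0` it is `1`). -/
def partitionTerm (w : S → S → ℂ) (m : Measure S) (ξ : S → ℂ) (Λ : Set S) (n : ℕ) : ℂ :=
  (n ! : ℂ)⁻¹ * ∫ x in Set.univ.pi fun _ : Fin n => Λ, omega w x * ∏ i, ξ (x i)
    ∂(Measure.pi fun _ => m)

/-- The grand-canonical partition function `Ξ_Λ(ν)`. -/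
def partitionFunction (w : S → S → ℂ) (m : Measure S) (ξ : S → ℂ) (Λ : Set S) : ℂ :=
  1 + ∑' n : ℕ, partitionTerm w m ξ Λ (n + 1)

/-- The formal power series in `z` of `Ξ_Λ(zν)`. -/
def partitionSeries (w : S → S → ℂ) (m : Measure S) (ξ : S → ℂ) (Λ : Set S) : PowerSeries ℂ :=
  PowerSeries.mk (partitionTerm w m ξ Λ)

/-- The formal power series in `z` of `ln Ξ_Λ(zν)`. -/
def logPartitionSeries (w : S → S → ℂ) (m : Measure S) (ξ : S → ℂ) (Λ : Set S) : PowerSeries ℂ :=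
  PowerSeries.logOf (partitionSeries w m ξ Λ)

/-- `L` is the value of `ln Ξ_Λ(ν)`: the value at `t = 1` of the continuous logarithm of
`t ↦ Ξ_Λ(tν)` on `[0,1]` that vanishes at `t = 0`, where `Ξ_Λ = 1`.  There is at most one
such `L`, and for positive `Ξ_Λ(tν)` it is the real logarithm. -/
def IsLogPartition (w : S → S → ℂ) (m : Measure S) (ξ : S → ℂ) (Λ : Set S) (L : ℂ) : Prop :=
  ∃ l : ℝ → ℂ, ContinuousOn l (Set.Icc 0 1) ∧ l 0 = 0 ∧ l 1 = L ∧
    ∀ t ∈ Set.Icc (0 : ℝ) 1,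
      Complex.exp (l t) = partitionFunction w m (fun x => (t : ℂ) * ξ x) Λ

end

end ClusterExp

/-!
For the tree bound, root the connected graphs on `{0, …, n}` at `0` and send each of them to the
spanning tree in which every vertex keeps its least neighbour of the previous generation (Penrose).
The graphs sent to a given tree `T` form an interval `[T, T ⊔ E]`, so summing over the optional
edges turns their Mayer weights `w - 1` into factors `w`. Since `|w| ≤ 1`, all these factors except
those between siblings can be dropped, and what remains is the summand of `B_n` for `T`.

For the logarithm, expand `ω_n` over all graphs and split off the connected component of one vertex.
After integration this says `Ξ' = Ξ C'` for the exponential generating function `C` of the integrals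
of `ω^T_n`, whence `C = log Ξ` as formal series, and the bound on `|c_{n+1}|` is `1/(n+1)! ≤ 1/n!`.
If `∑ |c_n|` converges, the same differential equation, solved in the open unit disc and extended by
continuity to the closed one, shows that `t ↦ ∑ c_n t^n` is a continuous logarithm of `Ξ_Λ(tν)`. It
is the only one that vanishes at `0`, as `exp` is locally injective.
-/

namespace ClusterExp

open MeasureTheory
open scoped ENNReal Nat

section FormalLog

open PowerSeries

theorem mul_derivative_log {A : Type*} [CommRing A] [Algebra ℚ A] :
    (1 + X) * d⁄dX A (log A) = 1 := by
  ext n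
  rw [deriv_log, add_mul, one_mul, map_add, coeff_mk]
  rcases n with _ | n
  · simp
  · rw [coeff_succ_X_mul, coeff_mk, coeff_one, if_neg n.succ_ne_zero, ← map_add, pow_succ]
    simp

theorem mul_derivative_logOf {A : Type*} [CommRing A] [Algebra ℚ A] {f : A⟦X⟧}
    (hf : constantCoeff f = 1) : f * d⁄dX A (logOf f) = d⁄dX A f := by
  have hs : HasSubst (f - 1) := HasSubst.of_constantCoeff_zero' (by simp [hf])
  have hsubst : f * (d⁄dX A (log A)).subst (f - 1) = 1 := by
    have h := congrArg (substAlgHom hs) (mul_derivative_log (A := A))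
    rwa [map_mul, map_add, map_one, substAlgHom_X, add_sub_cancel, coe_substAlgHom] at h
  calc f * d⁄dX A (logOf f)
      = f * ((d⁄dX A (log A)).subst (f - 1) * d⁄dX A (f - 1)) := by
        rw [logOf_eq, derivative_subst hs]
    _ = d⁄dX A f := by rw [← mul_assoc, hsubst, one_mul, map_sub, derivative_one, sub_zero]

theorem eq_logOf_of_mul_derivative {A : Type*} [CommRing A] [Algebra ℚ A] {f g : A⟦X⟧}
    (hf : constantCoeff f = 1) (hg : constantCoeff g = 0) (h : f * d⁄dX A g = d⁄dX A f) :
    g = logOf f := by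
  have hunit : IsUnit f := isUnit_iff_constantCoeff.2 (by simp [hf])
  have : IsAddTorsionFree A := .of_module_rat A
  refine derivative.ext (hunit.mul_left_cancel (h.trans (mul_derivative_logOf hf).symm)) ?_
  rw [hg, constantCoeff_logOf hf]

/-- The exponential generating function `∑ aₙ Xⁿ / n!`. -/
def egf {K : Type*} [Field K] (a : ℕ → K) : K⟦X⟧ :=
  mk fun n => (n ! : K)⁻¹ * a n

theorem egf_eq_logOf_egf {K : Type*} [Field K] [Algebra ℚ K] {a b : ℕ → K} (ha : a 0 = 1)
    (hb : b 0 = 0)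
    (h : ∀ n, a (n + 1) = ∑ k ∈ Finset.range (n + 1), (n.choose k : K) * (b (k + 1) * a (n - k))) :
    egf b = logOf (egf a) := by
  have := algebraRat.charZero K
  refine eq_logOf_of_mul_derivative (by simp [egf, ha]) (by simp [egf, hb]) ?_
  ext n
  rw [mul_comm, coeff_mul, Finset.Nat.sum_antidiagonal_eq_sum_range_succ_mk]
  simp only [egf, coeff_derivative, coeff_mk, h n, Nat.factorial_succ]
  rw [Finset.mul_sum, Finset.sum_mul]
  refine Finset.sum_congr rfl fun k hk => ?_
  have hkn : k ≤ n := Nat.lt_succ_iff.1 (Finset.mem_range.1 hk)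
  rw [Nat.cast_choose K hkn]
  push_cast
  have hfac : ∀ j : ℕ, (j ! : K) ≠ 0 := fun j => Nat.cast_ne_zero.2 j.factorial_ne_zero
  have hsucc : ∀ j : ℕ, (j : K) + 1 ≠ 0 := Nat.cast_add_one_ne_zero
  field_simp [hfac, hsucc]

end FormalLog

section SumOfSeries

open PowerSeries

variable {𝕜 : Type*} [RCLike 𝕜]

/-- The sum of a power series at a point; it is `0` by convention where the series is not
summable. -/
noncomputable def seriesSum (f : 𝕜⟦X⟧) (z : 𝕜) : 𝕜 :=
  ∑' n, coeff n f * z ^ n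

theorem seriesSum_zero_right (f : 𝕜⟦X⟧) : seriesSum f 0 = constantCoeff f := by
  rw [seriesSum, tsum_eq_single 0 fun n hn => by simp [hn]]
  simp

theorem seriesSum_one_right (f : 𝕜⟦X⟧) : seriesSum f 1 = ∑' n, coeff n f := by
  simp [seriesSum]

theorem norm_coeff_mul_pow_le (f : 𝕜⟦X⟧) {z : 𝕜} (hz : ‖z‖ ≤ 1) (n : ℕ) :
    ‖coeff n f * z ^ n‖ ≤ ‖coeff n f‖ := by
  rw [norm_mul, norm_pow]
  exact mul_le_of_le_one_right (norm_nonneg _) (pow_le_one₀ (norm_nonneg _) hz)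

theorem natCast_mul_pow_pred_le {r : ℝ} (hr₀ : 0 ≤ r) (hr₁ : r < 1) (n : ℕ) :
    n * r ^ (n - 1) ≤ (1 - r)⁻¹ := by
  calc n * r ^ (n - 1) = ∑ _k ∈ Finset.range n, r ^ (n - 1) := by simp
    _ ≤ ∑ k ∈ Finset.range n, r ^ k := Finset.sum_le_sum fun k hk =>
        pow_le_pow_of_le_one hr₀ hr₁.le (by grind)
    _ ≤ ∑' k : ℕ, r ^ k :=
        (summable_geometric_of_lt_one hr₀ hr₁).sum_le_tsum _ fun k _ => pow_nonneg hr₀ k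
    _ = (1 - r)⁻¹ := tsum_geometric_of_lt_one hr₀ hr₁

theorem seriesSum_mul {f g : 𝕜⟦X⟧} {z : 𝕜} (hf : Summable fun n => ‖coeff n f * z ^ n‖)
    (hg : Summable fun n => ‖coeff n g * z ^ n‖) :
    seriesSum (f * g) z = seriesSum f z * seriesSum g z := by
  simp only [seriesSum, tsum_mul_tsum_eq_tsum_sum_antidiagonal_of_summable_norm hf hg, coeff_mul,
    Finset.sum_mul]
  refine tsum_congr fun n => Finset.sum_congr rfl fun p hp => ?_
  rw [← Finset.HasAntidiagonal.mem_antidiagonal.1 hp, pow_add, mul_mul_mul_comm]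

variable {f : 𝕜⟦X⟧} (hf : Summable fun n => ‖coeff n f‖)
include hf

theorem continuousOn_seriesSum : ContinuousOn (seriesSum f) (Metric.closedBall 0 1) :=
  continuousOn_tsum (fun n => by fun_prop) hf fun n _ hz =>
    norm_coeff_mul_pow_le f (mem_closedBall_zero_iff.1 hz) n

theorem summable_norm_coeff_derivative_mul_pow {z : 𝕜} (hz : ‖z‖ < 1) :
    Summable fun n => ‖coeff n (d⁄dX 𝕜 f) * z ^ n‖ := by
  refine .of_nonneg_of_le (fun _ => norm_nonneg _) (fun n => ?_)
    (((summable_nat_add_iff 1).2 hf).mul_right (1 - ‖z‖)⁻¹)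
  have hn := natCast_mul_pow_pred_le (norm_nonneg z) hz (n + 1)
  rw [Nat.add_sub_cancel] at hn
  rw [coeff_derivative, mul_assoc, norm_mul, norm_mul, norm_pow, ← Nat.cast_succ,
    RCLike.norm_natCast]
  gcongr

theorem hasDerivAt_seriesSum {z : 𝕜} (hz : ‖z‖ < 1) :
    HasDerivAt (seriesSum f) (seriesSum (d⁄dX 𝕜 f) z) z := by
  obtain ⟨r, hzr, hr₁⟩ := exists_between hz
  have hr₀ : 0 ≤ r := (norm_nonneg z).trans hzr.le
  have hbound : ∀ n : ℕ, ∀ y ∈ Metric.ball (0 : 𝕜) r,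
      ‖coeff n f * (n * y ^ (n - 1))‖ ≤ ‖coeff n f‖ * (1 - r)⁻¹ := fun n y hy => by
    have hyr : ‖y‖ ≤ r := (mem_ball_zero_iff.1 hy).le
    have hn := natCast_mul_pow_pred_le hr₀ hr₁ n
    rw [norm_mul, norm_mul, norm_pow, RCLike.norm_natCast]
    gcongr
    exact le_trans (by gcongr) hn
  have hzmem : z ∈ Metric.ball (0 : 𝕜) r := mem_ball_zero_iff.2 hzr
  have hderiv := hasDerivAt_tsum_of_isPreconnected (hf.mul_right _) Metric.isOpen_ball
    (convex_ball (0 : 𝕜) r).isPreconnected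
    (fun n y _ => (hasDerivAt_pow n y).const_mul (coeff n f)) hbound hzmem
    (.of_norm_bounded hf (norm_coeff_mul_pow_le f hz.le)) hzmem
  have hsum : Summable fun n : ℕ => coeff n f * (n * z ^ (n - 1)) :=
    .of_norm_bounded (hf.mul_right _) fun n => hbound n z hzmem
  refine hderiv.congr_deriv (hsum.tsum_eq_zero_add.trans ?_)
  simp only [Nat.cast_zero, zero_mul, mul_zero, zero_add, Nat.add_sub_cancel, seriesSum,
    coeff_derivative, Nat.cast_add, Nat.cast_one, mul_assoc]

end SumOfSeries

section ContinuousLogarithm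

open PowerSeries

/-- With `F` and `l` the sums of the two series, `F * exp (-l)` has derivative
`(F' - F * l') * exp (-l) = 0` in the open disc. -/
theorem exp_seriesSum_logOf {f : ℂ⟦X⟧} (hf : Summable fun n => ‖coeff n f‖)
    (hlog : Summable fun n => ‖coeff n (logOf f)‖) (hf₀ : constantCoeff f = 1) {z : ℂ}
    (hz : ‖z‖ ≤ 1) : Complex.exp (seriesSum (logOf f) z) = seriesSum f z := by
  set H : ℂ → ℂ := fun z => seriesSum f z * Complex.exp (-seriesSum (logOf f) z) with hH
  have hderiv : ∀ y ∈ Metric.ball (0 : ℂ) 1, HasDerivAt H 0 y := fun y hy => by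
    have hy₁ : ‖y‖ < 1 := mem_ball_zero_iff.1 hy
    have hF' : seriesSum (d⁄dX ℂ f) y = seriesSum f y * seriesSum (d⁄dX ℂ (logOf f)) y := by
      rw [← mul_derivative_logOf hf₀]
      exact seriesSum_mul (hf.of_nonneg_of_le (fun _ => norm_nonneg _)
        (norm_coeff_mul_pow_le f hy₁.le)) (summable_norm_coeff_derivative_mul_pow hlog hy₁)
    refine ((hasDerivAt_seriesSum hf hy₁).mul
      (hasDerivAt_seriesSum hlog hy₁).neg.cexp).congr_deriv ?_
    rw [hF']
    ring
  have hcont : ContinuousOn H (Metric.closedBall 0 1) :=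
    (continuousOn_seriesSum hf).mul (continuousOn_seriesSum hlog).neg.cexp
  have hball : Set.EqOn H 1 (Metric.ball 0 1) := fun y hy => by
    rw [Metric.isOpen_ball.is_const_of_deriv_eq_zero (convex_ball _ _).isPreconnected
      (fun x hx => (hderiv x hx).differentiableAt.differentiableWithinAt)
      (fun x hx => (hderiv x hx).deriv) hy (Metric.mem_ball_self one_pos)]
    simp [hH, seriesSum_zero_right, hf₀, constantCoeff_logOf hf₀]
  have hclosed : Set.EqOn H 1 (Metric.closedBall 0 1) := by
    rw [← closure_ball (0 : ℂ) one_ne_zero] at hcont ⊢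
    exact hball.of_subset_closure hcont continuousOn_const subset_closure subset_rfl
  have hone : seriesSum f z * Complex.exp (-seriesSum (logOf f) z) = 1 :=
    hclosed (mem_closedBall_zero_iff.2 hz)
  rw [Complex.exp_neg] at hone
  exact (div_eq_one_iff_eq (Complex.exp_ne_zero _)).1 hone |>.symm

theorem isLocallyInjective_exp : IsLocallyInjective Complex.exp := fun z => by
  have h := (Complex.hasStrictDerivAt_exp z).hasStrictFDerivAt_equiv (Complex.exp_ne_zero z)
  exact ⟨_, (h.toOpenPartialHomeomorph Complex.exp).open_source,
    h.mem_toOpenPartialHomeomorph_source, (h.toOpenPartialHomeomorph Complex.exp).injOn⟩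

theorem eqOn_of_exp_eq {X : Type*} [TopologicalSpace X] {s : Set X} (hs : IsPreconnected s)
    {l l' : X → ℂ} (hl : ContinuousOn l s) (hl' : ContinuousOn l' s)
    (hexp : ∀ t ∈ s, Complex.exp (l t) = Complex.exp (l' t)) {a : X} (ha : a ∈ s)
    (hla : l a = l' a) : Set.EqOn l l' s :=
  (T2Space.isSeparatedMap Complex.exp).eqOn_of_comp_eqOn isLocallyInjective_exp hs hl hl' hexp ha
    hla

end ContinuousLogarithm

section Penrose

variable {V : Type*} {G T : SimpleGraph V} {r i j k : V}

/-- The neighbours of `j` that lie one generation closer to the root `r`. -/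
def parents (G : SimpleGraph V) (r j : V) : Set V :=
  {k | G.Adj k j ∧ G.dist r j = G.dist r k + 1}

theorem ne_root_of_mem_parents (h : k ∈ parents G r j) : j ≠ r := by
  rintro rfl
  simpa using h.2

theorem parents_nonempty (hG : G.Connected) (hj : j ≠ r) : (parents G r j).Nonempty := by
  obtain ⟨p, hp⟩ := hG.exists_walk_length_eq_dist j r
  cases p with
  | nil => exact absurd rfl hj
  | @cons _ k _ h q =>
    have hq := G.dist_le q
    have htri : G.dist j r ≤ G.dist j k + G.dist k r := hG.dist_triangle
    rw [SimpleGraph.dist_eq_one_iff_adj.2 h] at htri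
    rw [SimpleGraph.Walk.length_cons] at hp
    refine ⟨k, h.symm, ?_⟩
    rw [G.dist_comm (u := r), G.dist_comm (u := r)]
    omega

theorem subsingleton_parents (hT : T.IsTree) (r j : V) : (parents T r j).Subsingleton := by
  have exists_path : ∀ k ∈ parents T r j, ∃ p : T.Walk j r, p.IsPath ∧ p.snd = k := by
    rintro k ⟨hadj, hdist⟩
    obtain ⟨p, hp⟩ := hT.connected.exists_walk_length_eq_dist k r
    refine ⟨.cons hadj.symm p, SimpleGraph.Walk.isPath_of_length_eq_dist _ ?_, by simp⟩
    rw [SimpleGraph.Walk.length_cons, hp, T.dist_comm, ← hdist, T.dist_comm]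
  intro k hk k' hk'
  obtain ⟨p, hp, rfl⟩ := exists_path k hk
  obtain ⟨q, hq, rfl⟩ := exists_path k' hk'
  rw [(hT.existsUnique_path j r).unique hp hq]

theorem mem_parents_or_mem_parents_of_adj (hT : T.IsTree) (r : V) (h : T.Adj i j) :
    i ∈ parents T r j ∨ j ∈ parents T r i :=
  (hT.dist_eq_dist_add_one_of_adj r h).symm.imp (⟨h, ·⟩) (⟨h.symm, ·⟩)

theorem le_add_length_of_forall_adj {d : V → ℕ} (hd : ∀ a b, G.Adj a b → d b ≤ d a + 1) {a b : V}
    (p : G.Walk a b) : d b ≤ d a + p.length := by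
  induction p with
  | nil => simp
  | cons h q ih =>
    have := hd _ _ h
    rw [SimpleGraph.Walk.length_cons]
    omega

variable [LinearOrder V]

/-- The Penrose tree of a connected graph with root `r`: every vertex other than `r` is joined to
its least parent. -/
def penroseTree (G : SimpleGraph V) (r : V) : SimpleGraph V :=
  .fromRel fun i j => IsLeast (parents G r j) i

theorem penroseTree_adj :
    (penroseTree G r).Adj i j ↔ IsLeast (parents G r j) i ∨ IsLeast (parents G r i) j := by
  refine (SimpleGraph.fromRel_adj _ _ _).trans (and_iff_right_of_imp ?_)
  rintro (h | h)
  exacts [h.1.1.ne, h.1.1.ne']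

theorem penroseTree_le (G : SimpleGraph V) (r : V) : penroseTree G r ≤ G := by
  intro i j h
  rcases penroseTree_adj.1 h with h | h
  exacts [h.1.1, h.1.1.symm]

/-- The edges that can be added to the tree `T` without changing its Penrose tree: those within a
generation, and those from `j` to a vertex of the previous generation larger than the parent
of `j`. -/
def penroseExtra (T : SimpleGraph V) (r : V) : SimpleGraph V :=
  .fromRel fun i j => T.dist r i = T.dist r j ∨
    T.dist r j = T.dist r i + 1 ∧ ∃ k ∈ parents T r j, k < i

theorem penroseExtra_adj :
    (penroseExtra T r).Adj i j ↔ i ≠ j ∧ (T.dist r i = T.dist r j ∨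
      (T.dist r j = T.dist r i + 1 ∧ ∃ k ∈ parents T r j, k < i) ∨
      (T.dist r i = T.dist r j + 1 ∧ ∃ k ∈ parents T r i, k < j)) := by
  rw [penroseExtra, SimpleGraph.fromRel_adj]
  grind

theorem disjoint_penroseExtra (hT : T.IsTree) (r : V) : Disjoint T (penroseExtra T r) := by
  rw [SimpleGraph.disjoint_left]
  intro i j h hextra
  rcases (penroseExtra_adj.1 hextra).2 with hdist | ⟨hdist, k, hk, hlt⟩ | ⟨hdist, k, hk, hlt⟩
  · exact hT.dist_ne_of_adj r h hdist
  · exact hlt.ne (subsingleton_parents hT r j hk ⟨h, hdist⟩)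
  · exact hlt.ne (subsingleton_parents hT r i hk ⟨h.symm, hdist⟩)

theorem dist_eq_of_le_sup_penroseExtra (hT : T.IsTree) (hTG : T ≤ G)
    (hGT : G ≤ T ⊔ penroseExtra T r) (j : V) : G.dist r j = T.dist r j := by
  refine le_antisymm (SimpleGraph.Reachable.dist_anti hTG (hT.connected r j)) ?_
  have dist_le_succ : ∀ a b, G.Adj a b → T.dist r b ≤ T.dist r a + 1 := fun a b h => by
    rcases hGT h with h | h
    · have := hT.dist_eq_dist_add_one_of_adj r h
      omega
    · have := (penroseExtra_adj.1 h).2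
      omega
  obtain ⟨p, hp⟩ := (hT.connected.mono hTG).exists_walk_length_eq_dist r j
  simpa [hp] using le_add_length_of_forall_adj dist_le_succ p

theorem isLeast_parents_of_le_sup_penroseExtra (hT : T.IsTree) (hTG : T ≤ G)
    (hGT : G ≤ T ⊔ penroseExtra T r) (hk : k ∈ parents T r j) : IsLeast (parents G r j) k := by
  have hdist := dist_eq_of_le_sup_penroseExtra hT hTG hGT
  refine ⟨⟨hTG hk.1, by rw [hdist, hdist, hk.2]⟩, ?_⟩
  rintro i ⟨hij, hi⟩
  rw [hdist, hdist] at hi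
  rcases hGT hij with h | h
  · exact (subsingleton_parents hT r j hk ⟨h, hi⟩).le
  · rcases (penroseExtra_adj.1 h).2 with h | ⟨-, k', hk', hlt⟩ | ⟨h, -⟩
    · omega
    · exact subsingleton_parents hT r j hk hk' ▸ hlt.le
    · omega

theorem penroseTree_eq_of_le_sup_penroseExtra (hT : T.IsTree) (hTG : T ≤ G)
    (hGT : G ≤ T ⊔ penroseExtra T r) : penroseTree G r = T := by
  have isLeast_iff : ∀ i j, IsLeast (parents G r j) i ↔ i ∈ parents T r j := fun i j => by
    refine ⟨fun hi => ?_, isLeast_parents_of_le_sup_penroseExtra hT hTG hGT⟩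
    obtain ⟨k, hk⟩ := parents_nonempty hT.connected (ne_root_of_mem_parents hi.1)
    rwa [hi.unique (isLeast_parents_of_le_sup_penroseExtra hT hTG hGT hk)]
  ext i j
  rw [penroseTree_adj, isLeast_iff, isLeast_iff]
  refine ⟨?_, mem_parents_or_mem_parents_of_adj hT r⟩
  rintro (h | h)
  exacts [h.1, h.1.symm]

section WellFoundedLT

variable [WellFoundedLT V] (hG : G.Connected)
include hG

theorem exists_isLeast_parents (hj : j ≠ r) : ∃ k, IsLeast (parents G r j) k :=
  ⟨_, WellFounded.min_mem wellFounded_lt _ (parents_nonempty hG hj),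
    fun _ hi => not_lt.1 (WellFounded.not_lt_min wellFounded_lt _ hi)⟩

theorem exists_walk_penroseTree_length_eq_dist (r j : V) :
    ∃ p : (penroseTree G r).Walk r j, p.length = G.dist r j := by
  induction hd : G.dist r j generalizing j with
  | zero =>
    obtain rfl := hG.dist_eq_zero_iff.1 hd
    exact ⟨.nil, rfl⟩
  | succ d ih =>
    have hj : j ≠ r := by
      rintro rfl
      simp at hd
    obtain ⟨k, hk⟩ := exists_isLeast_parents hG hj
    obtain ⟨p, hp⟩ := ih k (Nat.succ_injective (hk.1.2.symm.trans hd))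
    exact ⟨p.concat (penroseTree_adj.2 (.inl hk)), by simp [hp]⟩

theorem connected_penroseTree (r : V) : (penroseTree G r).Connected :=
  (SimpleGraph.connected_iff_exists_forall_reachable _).2
    ⟨r, fun j => (exists_walk_penroseTree_length_eq_dist hG r j).choose.reachable⟩

theorem dist_penroseTree (r j : V) : (penroseTree G r).dist r j = G.dist r j := by
  obtain ⟨p, hp⟩ := exists_walk_penroseTree_length_eq_dist hG r j
  exact le_antisymm (hp ▸ SimpleGraph.dist_le p)
    (SimpleGraph.Reachable.dist_anti (penroseTree_le G r) p.reachable)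

theorem le_penroseTree_sup_penroseExtra (r : V) :
    G ≤ penroseTree G r ⊔ penroseExtra (penroseTree G r) r := by
  have exists_smaller_parent : ∀ {i j}, i ∈ parents G r j → ¬ (penroseTree G r).Adj i j →
      ∃ k ∈ parents (penroseTree G r) r j, k < i := fun {i j} hi hij => by
    obtain ⟨k, hk⟩ := exists_isLeast_parents hG (ne_root_of_mem_parents hi)
    refine ⟨k, ⟨penroseTree_adj.2 (.inl hk), ?_⟩, (hk.2 hi).lt_of_ne ?_⟩
    · rw [dist_penroseTree hG, dist_penroseTree hG, hk.1.2]
    · rintro rfl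
      exact hij (penroseTree_adj.2 (.inl hk))
  intro i j h
  refine or_iff_not_imp_left.2 fun hij => penroseExtra_adj.2 ⟨h.ne, ?_⟩
  rw [dist_penroseTree hG, dist_penroseTree hG]
  have hdist : G.dist r i = G.dist r j ∨ G.dist r j = G.dist r i + 1 ∨
      G.dist r i = G.dist r j + 1 := by
    have := h.diff_dist_adj (u := r)
    omega
  exact hdist.imp_right (Or.imp (fun hdist => ⟨hdist, exists_smaller_parent ⟨h, hdist⟩ hij⟩)
    fun hdist => ⟨hdist, exists_smaller_parent ⟨h.symm, hdist⟩ (hij ·.symm)⟩)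

theorem penroseTree_eq_iff (hT : T.IsTree) :
    penroseTree G r = T ↔ T ≤ G ∧ G ≤ T ⊔ penroseExtra T r := by
  refine ⟨?_, fun h => penroseTree_eq_of_le_sup_penroseExtra hT h.1 h.2⟩
  rintro rfl
  exact ⟨penroseTree_le G r, le_penroseTree_sup_penroseExtra hG r⟩

end WellFoundedLT

theorem isTree_penroseTree [Finite V] (hG : G.Connected) (r : V) : (penroseTree G r).IsTree := by
  have hconn := connected_penroseTree hG r
  refine SimpleGraph.isTree_iff_connected_and_card.2
    ⟨hconn, le_antisymm ?_ hconn.card_vert_le_card_edgeSet_add_one⟩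
  choose! p hp using fun j (hj : j ≠ r) => exists_isLeast_parents hG hj
  have edgeSet_subset : (penroseTree G r).edgeSet ⊆ (fun j => s(p j, j)) '' {r}ᶜ := by
    rintro ⟨i, j⟩ h
    rcases penroseTree_adj.1 h with h | h
    · have hj := ne_root_of_mem_parents h.1
      exact ⟨j, hj, congrArg (s(·, j)) ((hp j hj).unique h)⟩
    · have hi := ne_root_of_mem_parents h.1
      exact ⟨i, hi, (congrArg (s(·, i)) ((hp i hi).unique h)).trans Sym2.eq_swap⟩
  calc Nat.card (penroseTree G r).edgeSet + 1 ≤ ({r}ᶜ : Set V).ncard + 1 := by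
        gcongr
        exact (Set.ncard_le_ncard edgeSet_subset).trans (Set.ncard_image_le)
    _ = Nat.card V := by rw [← Set.ncard_add_ncard_compl {r}, Set.ncard_singleton, add_comm]

end Penrose

section GraphWeight

theorem enorm_prod {ι K : Type*} [NormedField K] (s : Finset ι) (f : ι → K) :
    ‖∏ i ∈ s, f i‖ₑ = ∏ i ∈ s, ‖f i‖ₑ := by
  simp only [enorm_eq_nnnorm, nnnorm_prod, ENNReal.ofNNReal_finsetProd]

variable {V W : Type*} [Fintype V] [Fintype W]

open Classical in
/-- The product of the weights of the edges of a graph. -/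
noncomputable def graphWeight {M : Type*} [CommMonoid M] (f : Sym2 V → M) (G : SimpleGraph V) : M :=
  ∏ e ∈ G.edgeFinset, f e

theorem enorm_graphWeight {K : Type*} [NormedField K] (f : Sym2 V → K) (G : SimpleGraph V) :
    ‖graphWeight f G‖ₑ = graphWeight (fun e => ‖f e‖ₑ) G :=
  enorm_prod _ f

variable {M : Type*} [CommMonoid M]

theorem graphWeight_eq_prod_edgeFinset (f : Sym2 V → M) (G : SimpleGraph V) [Fintype G.edgeSet] :
    graphWeight f G = ∏ e ∈ G.edgeFinset, f e := by
  rw [graphWeight]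
  congr!

theorem graphWeight_sup {G H : SimpleGraph V} (h : Disjoint G H) (f : Sym2 V → M) :
    graphWeight f (G ⊔ H) = graphWeight f G * graphWeight f H := by
  classical
  simp only [graphWeight_eq_prod_edgeFinset]
  rw [SimpleGraph.edgeFinset_sup, Finset.prod_union (SimpleGraph.disjoint_edgeFinset.2 h)]

theorem graphWeight_map (e : V ↪ W) (f : Sym2 W → M) (G : SimpleGraph V) :
    graphWeight f (G.map e) = graphWeight (fun a => f (a.map e)) G := by
  classical
  simp only [graphWeight_eq_prod_edgeFinset]
  rw [SimpleGraph.edgeFinset_map, Finset.prod_map]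
  rfl

theorem graphWeight_simpleGraph (e : V ≃ W) (f : Sym2 W → M) (G : SimpleGraph V) :
    graphWeight f (e.simpleGraph G) = graphWeight (fun a => f (a.map e)) G := by
  refine Eq.trans ?_ (graphWeight_map e.toEmbedding f G)
  rw [← SimpleGraph.comap_symm]
  rfl

theorem graphWeight_eq_prod_lt [LinearOrder V] {f : Sym2 V → M} {G : SimpleGraph V}
    [DecidablePred fun p : V × V => p.1 < p.2 ∧ G.Adj p.1 p.2] :
    graphWeight f G = ∏ p : V × V with p.1 < p.2 ∧ G.Adj p.1 p.2, f s(p.1, p.2) := by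
  classical
  refine (Finset.prod_nbij (s := {p : V × V | p.1 < p.2 ∧ G.Adj p.1 p.2}) (t := G.edgeFinset)
    (fun p => s(p.1, p.2)) ?_ ?_ ?_ fun _ _ => rfl).symm
  · intro p hp
    exact SimpleGraph.mem_edgeFinset.2 (Finset.mem_filter.1 hp).2.2
  · rintro ⟨i, j⟩ hp ⟨i', j'⟩ hp' h
    have hlt := (Finset.mem_filter.1 hp).2.1
    have hlt' := (Finset.mem_filter.1 hp').2.1
    rcases Sym2.eq_iff.1 h with ⟨rfl, rfl⟩ | ⟨rfl, rfl⟩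
    · rfl
    · exact absurd hlt hlt'.asymm
  · rintro ⟨i, j⟩ hij
    have hadj : G.Adj i j := SimpleGraph.mem_edgeFinset.1 hij
    rcases hadj.ne.lt_or_gt with hij | hij
    · exact ⟨(i, j), by simp [hij, hadj], rfl⟩
    · exact ⟨(j, i), by simp [hij, hadj.symm], Sym2.eq_swap⟩

end GraphWeight

section GraphSum

variable {V W : Type*} [Fintype V] [DecidableEq V] [Fintype W] [DecidableEq W]
  {R : Type*}

open Classical in
theorem sum_graphWeight_le [CommSemiring R] (f : Sym2 V → R) (A : SimpleGraph V) :
    ∑ H : SimpleGraph V with H ≤ A, graphWeight f H = graphWeight (fun e => 1 + f e) A := by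
  rw [graphWeight_eq_prod_edgeFinset, Finset.prod_one_add]
  refine Finset.sum_nbij (fun H => H.edgeFinset) ?_ ?_ ?_ fun H _ =>
    graphWeight_eq_prod_edgeFinset f H
  · intro H hH
    simpa using hH
  · exact fun G _ H _ h => SimpleGraph.edgeFinset_inj.1 h
  · intro t ht
    have ht : t ⊆ A.edgeFinset := Finset.mem_powerset.1 ht
    have hedge : (SimpleGraph.fromEdgeSet (t : Set (Sym2 V))).edgeFinset = t := by
      ext a
      simpa using fun ha => A.not_isDiag_of_mem_edgeFinset (ht ha)
    refine ⟨.fromEdgeSet t, ?_, by convert hedge⟩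
    rw [Finset.mem_coe, Finset.mem_filter_univ, ← SimpleGraph.edgeFinset_subset_edgeFinset]
    convert ht

open Classical in
theorem sum_Icc_graphWeight [CommSemiring R] (f : Sym2 V → R) {T A : SimpleGraph V}
    (h : Disjoint T A) :
    ∑ G : SimpleGraph V with T ≤ G ∧ G ≤ T ⊔ A, graphWeight f G =
      graphWeight f T * graphWeight (fun e => 1 + f e) A := by
  rw [← sum_graphWeight_le, Finset.mul_sum]
  refine (Finset.sum_nbij' (T ⊔ ·) (· \ T) ?_ ?_ ?_ ?_ ?_).symm
  · intro H hH
    have hH : H ≤ A := by simpa using hH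
    simpa using le_sup_of_le_right hH
  · intro G hG
    have hG : T ≤ G ∧ G ≤ T ⊔ A := by simpa using hG
    simpa using hG.2
  · intro H hH
    have hH : H ≤ A := by simpa using hH
    exact (h.mono_right hH).sup_sdiff_cancel_left
  · intro G hG
    have hG : T ≤ G ∧ G ≤ T ⊔ A := by simpa using hG
    exact sup_sdiff_cancel_right hG.1
  · intro H hH
    have hH : H ≤ A := by simpa using hH
    exact (graphWeight_sup (h.mono_right hH) f).symm

variable [CommSemiring R]

/-- The sum over all graphs of the product of the edge weights. -/
noncomputable def graphSum (f : Sym2 V → R) : R :=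
  ∑ G : SimpleGraph V, graphWeight f G

open Classical in
/-- The sum over the connected graphs of the product of the edge weights. -/
noncomputable def connectedSum (f : Sym2 V → R) : R :=
  ∑ G : SimpleGraph V with G.Connected, graphWeight f G

theorem graphSum_eq_graphWeight_top (f : Sym2 V → R) :
    graphSum f = graphWeight (fun e => 1 + f e) ⊤ := by
  simpa [graphSum] using sum_graphWeight_le f ⊤

open Classical in
/-- Penrose's tree-graph identity: the connected graphs with Penrose tree `T` are the graphs
between `T` and `T ⊔ penroseExtra T r`. -/
theorem connectedSum_eq_sum_isTree [LinearOrder V] (f : Sym2 V → R) (r : V) :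
    connectedSum f = ∑ T : SimpleGraph V with T.IsTree,
      graphWeight f T * graphWeight (fun e => 1 + f e) (penroseExtra T r) := by
  rw [connectedSum, ← Finset.sum_fiberwise_of_maps_to (t := {T | T.IsTree})
    (g := fun G => penroseTree G r) fun G hG => by
      simpa using isTree_penroseTree (by simpa using hG) r]
  refine Finset.sum_congr rfl fun T hT => ?_
  have hT : T.IsTree := by simpa using hT
  rw [← sum_Icc_graphWeight f (disjoint_penroseExtra hT r)]
  congr 1
  ext G
  simp only [Finset.mem_filter, Finset.mem_univ, true_and]
  constructor
  · exact fun h => (penroseTree_eq_iff h.1 hT).1 h.2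
  · exact fun h => ⟨hT.connected.mono h.1, (penroseTree_eq_iff (hT.connected.mono h.1) hT).2 h⟩

theorem graphSum_comp_equiv (e : V ≃ W) (f : Sym2 W → R) :
    graphSum (fun a => f (a.map e)) = graphSum f := by
  rw [graphSum, graphSum, ← e.simpleGraph.sum_comp]
  exact Finset.sum_congr rfl fun G _ => (graphWeight_simpleGraph e f G).symm

theorem connectedSum_comp_equiv (e : V ≃ W) (f : Sym2 W → R) :
    connectedSum (fun a => f (a.map e)) = connectedSum f := by
  rw [connectedSum, connectedSum]
  refine Finset.sum_equiv e.simpleGraph (fun G => ?_) fun G _ =>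
    (graphWeight_simpleGraph e f G).symm
  simpa using (SimpleGraph.Iso.comap e.symm G).connected_iff.symm

end GraphSum

section TreeBound

variable {n : ℕ} {T : SimpleGraph (Fin (n + 1))} {i j : Fin (n + 1)}

theorem mem_children : j ∈ children T i ↔ i ∈ parents T 0 j := by
  simp only [children, parents, Finset.mem_filter_univ, Set.mem_ofPred_eq]

theorem graphWeight_eq_prod_children {M : Type*} [CommMonoid M] (hT : T.IsTree)
    (f : Sym2 (Fin (n + 1)) → M) :
    graphWeight f T = ∏ i, ∏ j ∈ children T i, f s(i, j) := by
  classical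
  rw [Finset.prod_sigma', graphWeight_eq_prod_edgeFinset]
  refine (Finset.prod_nbij (fun a : Σ _ : Fin (n + 1), Fin (n + 1) => s(a.1, a.2)) ?_ ?_ ?_
    fun _ _ => rfl).symm
  · intro a ha
    exact SimpleGraph.mem_edgeFinset.2 (mem_children.1 (Finset.mem_sigma.1 ha).2).1
  · rintro ⟨i, j⟩ h ⟨i', j'⟩ h' heq
    have hij := (mem_children.1 (Finset.mem_sigma.1 h).2).2
    have hij' := (mem_children.1 (Finset.mem_sigma.1 h').2).2
    rcases Sym2.eq_iff.1 heq with ⟨rfl, rfl⟩ | ⟨rfl, rfl⟩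
    · rfl
    · dsimp only at hij hij'
      omega
  · rintro ⟨i, j⟩ hij
    rcases mem_parents_or_mem_parents_of_adj hT 0 (SimpleGraph.mem_edgeFinset.1 hij) with h | h
    · exact ⟨⟨i, j⟩, by simpa [mem_children] using h, rfl⟩
    · exact ⟨⟨j, i⟩, by simpa [mem_children] using h, Sym2.eq_swap⟩

theorem graphWeight_penroseExtra_le {f : Sym2 (Fin (n + 1)) → ℝ≥0∞} (hf : ∀ e, f e ≤ 1)
    (hT : T.IsTree) :
    graphWeight f (penroseExtra T 0) ≤
      ∏ i, ∏ p ∈ children T i ×ˢ children T i with p.1 < p.2, f s(p.1, p.2) := by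
  classical
  rw [← Finset.prod_biUnion, graphWeight_eq_prod_lt]
  · refine Finset.prod_le_prod_of_subset_of_le_one' ?_ fun p _ _ => hf _
    intro p hp
    simp only [Finset.mem_biUnion, Finset.mem_univ, true_and, Finset.mem_filter,
      Finset.mem_product, mem_children] at hp
    obtain ⟨i, ⟨h₁, h₂⟩, hlt⟩ := hp
    exact (Finset.mem_filter_univ _).2
      ⟨hlt, penroseExtra_adj.2 ⟨hlt.ne, .inl (h₁.2.trans h₂.2.symm)⟩⟩
  · intro i _ j _ hij
    refine Finset.disjoint_left.2 fun p hp hp' => hij ?_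
    simp only [Finset.mem_filter, Finset.mem_product, mem_children] at hp hp'
    exact subsingleton_parents hT 0 p.1 hp.1.1 hp'.1.1

variable {S : Type*} {w : S → S → ℂ}

/-- The Mayer edge weight `w(x, y) - 1` as a function of the unordered pair `{x, y}`. -/
def mayer (w : S → S → ℂ) (hw_symm : ∀ x y, w x y = w y x) : Sym2 S → ℂ :=
  Sym2.lift ⟨fun x y => w x y - 1, fun x y => congrArg (· - 1) (hw_symm x y)⟩

variable (hw_symm : ∀ x y, w x y = w y x)

theorem omegaT_eq_connectedSum (x : Fin n → S) :
    omegaT w x = connectedSum fun e => mayer w hw_symm (e.map x) := by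
  classical
  refine Finset.sum_congr rfl fun G _ => ?_
  rw [graphWeight_eq_prod_lt]
  rfl

theorem omega_eq_graphSum (x : Fin n → S) :
    omega w x = graphSum fun e => mayer w hw_symm (e.map x) := by
  classical
  rw [graphSum_eq_graphWeight_top, graphWeight_eq_prod_lt]
  refine Finset.prod_congr (Finset.filter_congr fun p _ => ?_) fun p _ => ?_
  · exact ⟨fun h => ⟨h, h.ne⟩, And.left⟩
  · exact (add_sub_cancel _ _).symm

include hw_symm in
theorem enorm_omegaT_le_treeWeight (hw_le : ∀ x y, ‖w x y‖ ≤ 1) (x : Fin (n + 1) → S) :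
    ‖omegaT w x‖ₑ ≤ treeWeight w x := by
  have enorm_le_one : ∀ e : Sym2 (Fin (n + 1)), ‖1 + mayer w hw_symm (e.map x)‖ₑ ≤ 1 := by
    rintro ⟨i, j⟩
    simpa [mayer, ← ofReal_norm] using hw_le (x i) (x j)
  rw [omegaT_eq_connectedSum hw_symm, connectedSum_eq_sum_isTree _ 0]
  refine (enorm_sum_le _ _).trans (Finset.sum_le_sum fun T hT => ?_)
  have hT : T.IsTree := by simpa using hT
  rw [enorm_mul, enorm_graphWeight, enorm_graphWeight, graphWeight_eq_prod_children hT]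
  refine (mul_le_mul_right (graphWeight_penroseExtra_le enorm_le_one hT) _).trans_eq ?_
  simp only [phi, Finset.prod_mul_distrib, Sym2.map_mk, mayer, Sym2.lift_mk, add_sub_cancel]

end TreeBound

section Component

variable {V : Type*} {p : V → Prop} {G : SimpleGraph V}

theorem iff_of_reachable (hp : ∀ i j, G.Adj i j → (p i ↔ p j)) {i j : V} (h : G.Reachable i j) :
    p i ↔ p j := by
  obtain ⟨q⟩ := h
  induction q with
  | nil => rfl
  | cons h _ ih => exact (hp _ _ h).trans ih

theorem forall_reachable_iff_iff {r : V} (hr : p r) :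
    (∀ i, G.Reachable r i ↔ p i) ↔
      (G.comap (Function.Embedding.subtype p)).Connected ∧ ∀ i j, G.Adj i j → (p i ↔ p j) := by
  constructor
  · intro h
    refine ⟨?_, fun i j hij => ?_⟩
    · obtain rfl : p = (· ∈ (G.connectedComponentMk r).supp) := by
        ext i
        simp [← h, SimpleGraph.reachable_comm]
      exact (G.connectedComponentMk r).connected_toSimpleGraph
    · rw [← h, ← h]
      exact ⟨(·.trans hij.reachable), (·.trans hij.symm.reachable)⟩
  · rintro ⟨hconn, hp⟩ i
    refine ⟨fun h => (iff_of_reachable hp h).1 hr, fun hi => ?_⟩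
    exact (hconn.preconnected ⟨r, hr⟩ ⟨i, hi⟩).map
      (SimpleGraph.Embedding.comap (Function.Embedding.subtype p) G).toHom

/-- The graph on `V` with no edge between the vertices that satisfy `p` and the others, given by
its restrictions to these two sets of vertices. -/
def joinSubtype (G₁ : SimpleGraph {i // p i}) (G₂ : SimpleGraph {i // ¬p i}) : SimpleGraph V :=
  G₁.map (Function.Embedding.subtype _) ⊔ G₂.map (Function.Embedding.subtype _)

variable {G₁ : SimpleGraph {i // p i}} {G₂ : SimpleGraph {i // ¬p i}}

theorem joinSubtype_adj {i j : V} : (joinSubtype G₁ G₂).Adj i j ↔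
    (∃ (hi : p i) (hj : p j), G₁.Adj ⟨i, hi⟩ ⟨j, hj⟩) ∨
      ∃ (hi : ¬p i) (hj : ¬p j), G₂.Adj ⟨i, hi⟩ ⟨j, hj⟩ := by
  simp only [joinSubtype, SimpleGraph.sup_adj, SimpleGraph.map_adj,
    Function.Embedding.subtype_apply, Subtype.exists]
  grind

theorem iff_of_joinSubtype_adj (i j : V) (h : (joinSubtype G₁ G₂).Adj i j) : p i ↔ p j := by
  rcases joinSubtype_adj.1 h with ⟨hi, hj, -⟩ | ⟨hi, hj, -⟩
  exacts [iff_of_true hi hj, iff_of_false hi hj]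

theorem comap_joinSubtype_left :
    (joinSubtype G₁ G₂).comap (Function.Embedding.subtype p) = G₁ := by
  ext ⟨i, hi⟩ ⟨j, hj⟩
  simp [joinSubtype_adj, hi, hj]

theorem comap_joinSubtype_right :
    (joinSubtype G₁ G₂).comap (Function.Embedding.subtype (¬p ·)) = G₂ := by
  ext ⟨i, hi⟩ ⟨j, hj⟩
  simp [joinSubtype_adj, hi, hj]

theorem joinSubtype_comap (hp : ∀ i j, G.Adj i j → (p i ↔ p j)) :
    joinSubtype (G.comap (Function.Embedding.subtype p))
      (G.comap (Function.Embedding.subtype (¬p ·))) = G := by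
  ext i j
  have := hp i j
  simp only [joinSubtype_adj, SimpleGraph.comap_adj, Function.Embedding.subtype_apply]
  grind

variable [Fintype V] [Fintype {i // p i}] [Fintype {i // ¬p i}]

theorem graphWeight_joinSubtype {M : Type*} [CommMonoid M] (f : Sym2 V → M) :
    graphWeight f (joinSubtype G₁ G₂) =
      graphWeight (fun e => f (e.map Subtype.val)) G₁ *
        graphWeight (fun e => f (e.map Subtype.val)) G₂ := by
  have hdisj : Disjoint (G₁.map (Function.Embedding.subtype p))
      (G₂.map (Function.Embedding.subtype (¬p ·))) := by
    rw [SimpleGraph.disjoint_left]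
    rintro _ _ ⟨-, ⟨i, _, -, rfl, -⟩⟩ ⟨-, ⟨j, _, -, h, -⟩⟩
    exact j.2 ((congrArg p h).mpr i.2)
  rw [joinSubtype, graphWeight_sup hdisj, graphWeight_map, graphWeight_map]
  rfl

variable [DecidableEq V] {R : Type*} [CommSemiring R]

theorem sum_graphWeight_component (f : Sym2 V → R) {r : V} (hr : p r)
    [DecidablePred fun G : SimpleGraph V => ∀ i, G.Reachable r i ↔ p i] :
    ∑ G : SimpleGraph V with ∀ i, G.Reachable r i ↔ p i, graphWeight f G =
      connectedSum (fun e : Sym2 {i // p i} => f (e.map Subtype.val)) *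
        graphSum (fun e : Sym2 {i // ¬p i} => f (e.map Subtype.val)) := by
  rw [connectedSum, graphSum, Finset.sum_mul_sum, ← Finset.sum_product']
  refine (Finset.sum_nbij' (fun q => joinSubtype q.1 q.2)
    (fun G => (G.comap (Function.Embedding.subtype _), G.comap (Function.Embedding.subtype _)))
    ?_ ?_ ?_ ?_ ?_).symm
  · rintro ⟨G₁, G₂⟩ hG
    have hG₁ : G₁.Connected := by simpa using hG
    rw [Finset.mem_filter_univ, forall_reachable_iff_iff hr, comap_joinSubtype_left]
    exact ⟨hG₁, iff_of_joinSubtype_adj⟩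
  · intro G hG
    have hG := (forall_reachable_iff_iff hr).1 ((Finset.mem_filter_univ _).1 hG)
    simpa using hG.1
  · exact fun q _ => Prod.ext comap_joinSubtype_left comap_joinSubtype_right
  · intro G hG
    have hG := (forall_reachable_iff_iff hr).1 ((Finset.mem_filter_univ _).1 hG)
    exact joinSubtype_comap hG.2
  · exact fun q _ => (graphWeight_joinSubtype f).symm

theorem graphSum_eq_sum_component (f : Sym2 V → R) (r : V) :
    graphSum f = ∑ s : Finset V with r ∈ s,
      connectedSum (fun e : Sym2 {i // i ∈ s} => f (e.map Subtype.val)) *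
        graphSum (fun e : Sym2 {i // i ∉ s} => f (e.map Subtype.val)) := by
  classical
  rw [graphSum, ← Finset.sum_fiberwise_of_maps_to (t := {s | r ∈ s})
    (g := fun G : SimpleGraph V => ({i | G.Reachable r i} : Finset V)) fun G _ => by simp]
  refine Finset.sum_congr rfl fun s hs => ?_
  rw [← sum_graphWeight_component f (p := (· ∈ s)) ((Finset.mem_filter_univ s).1 hs)]
  refine Finset.sum_congr (Finset.filter_congr fun G _ => ?_) fun _ _ => rfl
  simp only [Finset.ext_iff, Finset.mem_filter_univ]

end Component

theorem sum_card_of_mem {ι M : Type*} [Fintype ι] [DecidableEq ι] [AddCommMonoid M] (r : ι)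
    (f : ℕ → M) : ∑ s : Finset ι with r ∈ s, f s.card =
      ∑ k ∈ Finset.range (Fintype.card ι), (Fintype.card ι - 1).choose k • f (k + 1) := by
  have herase : ∑ s : Finset ι with r ∈ s, f s.card =
      ∑ t ∈ (Finset.univ.erase r).powerset, f (t.card + 1) := by
    refine Finset.sum_nbij' (·.erase r) (insert r ·) (fun s _ => ?_) (fun t _ => ?_)
      (fun s hs => Finset.insert_erase (Finset.mem_filter.1 hs).2) (fun t ht => ?_) (fun s hs => ?_)
    · exact Finset.mem_powerset.2 (Finset.erase_subset_erase r (Finset.subset_univ s))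
    · simp
    · exact Finset.erase_insert fun hr => Finset.notMem_erase r _ (Finset.mem_powerset.1 ht hr)
    · rw [Finset.card_erase_add_one (Finset.mem_filter.1 hs).2]
  rw [herase, Finset.sum_powerset_apply_card fun k => f (k + 1),
    Finset.card_erase_of_mem (Finset.mem_univ r), Finset.card_univ,
    Nat.sub_add_cancel (Fintype.card_pos_iff.2 ⟨r⟩)]

theorem integral_pi_comp_equiv {S ι κ E : Type*} [MeasurableSpace S] [Fintype ι] [Fintype κ]
    [NormedAddCommGroup E] [NormedSpace ℝ E] (μ : Measure S) [SigmaFinite μ] (e : κ ≃ ι)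
    (f : (κ → S) → E) :
    ∫ x : ι → S, f (x ∘ e) ∂Measure.pi (fun _ => μ) = ∫ x, f x ∂Measure.pi (fun _ => μ) := by
  have hmp := measurePreserving_piCongrLeft (fun _ : ι => μ) e
  rw [← hmp.integral_comp']
  refine integral_congr_ae (.of_forall fun x => congrArg f (funext fun k => ?_))
  exact Equiv.piCongrLeft_apply_apply (fun _ : ι => S) e x k

theorem measurePreserving_piEquivPiSubtypeProd_mem {S ι : Type*} [MeasurableSpace S] [Fintype ι]
    [DecidableEq ι] (μ : Measure S) [SigmaFinite μ] (s : Finset ι) :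
    MeasurePreserving (MeasurableEquiv.piEquivPiSubtypeProd (fun _ => S) (· ∈ s))
      (Measure.pi fun _ : ι => μ)
      ((Measure.pi fun _ : {i // i ∈ s} => μ).prod (Measure.pi fun _ : {i // i ∉ s} => μ)) := by
  convert measurePreserving_piEquivPiSubtypeProd (fun _ : ι => μ) (· ∈ s)

theorem measurable_graphWeight {S R ι : Type*} [MeasurableSpace S] [CommSemiring R]
    [MeasurableSpace R] [MeasurableMul₂ R] [Fintype ι] {F : Sym2 S → R}
    (hF : Measurable fun p : S × S => F s(p.1, p.2)) (G : SimpleGraph ι) :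
    Measurable fun x : ι → S => graphWeight (fun e => F (e.map x)) G := by
  refine Finset.measurable_prod _ ?_
  rintro ⟨i, j⟩ -
  have hpair : Measurable fun x : ι → S => (x i, x j) :=
    (measurable_pi_apply i).prodMk (measurable_pi_apply j)
  exact hF.comp hpair

theorem integrable_sum_graphWeight {S 𝕜 ι : Type*} [RCLike 𝕜] [MeasurableSpace S] [Fintype ι]
    {F : Sym2 S → 𝕜} {ξ : S → 𝕜} {μ : Measure S} [SigmaFinite μ] {C : ℝ}
    (hF : Measurable fun p : S × S => F s(p.1, p.2)) (hFC : ∀ e, ‖F e‖ ≤ C) (hξ : Integrable ξ μ)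
    (s : Finset (SimpleGraph ι)) :
    Integrable (fun x : ι → S => (∑ G ∈ s, graphWeight (fun e => F (e.map x)) G) * ∏ i, ξ (x i))
      (Measure.pi fun _ => μ) := by
  simp only [Finset.sum_mul]
  refine integrable_finsetSum _ fun G _ => ?_
  have hbdd : ∀ x : ι → S, ‖graphWeight (fun e => F (e.map x)) G‖ ≤
      graphWeight (fun _ => C) G := fun x => by
    rw [graphWeight, norm_prod]
    exact Finset.prod_le_prod (fun _ _ => norm_nonneg _) fun e _ => hFC _
  exact (Integrable.fintype_prod fun _ => hξ).bdd_mul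
    (measurable_graphWeight hF G).aestronglyMeasurable (.of_forall hbdd)

section ClusterIntegral

variable {S 𝕜 ι κ : Type*} [RCLike 𝕜] [Fintype ι] [DecidableEq ι] [Fintype κ] [DecidableEq κ]
  {F : Sym2 S → 𝕜} {ξ : S → 𝕜}

/-- The integrand of the partition function: `F` is the Mayer edge weight and `ξ` the density of
the complex measure. -/
noncomputable def graphIntegrand (F : Sym2 S → 𝕜) (ξ : S → 𝕜) (x : ι → S) : 𝕜 :=
  graphSum (fun e => F (e.map x)) * ∏ i, ξ (x i)

/-- The integrand of the cluster expansion: only the connected graphs are kept. -/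
noncomputable def connectedIntegrand (F : Sym2 S → 𝕜) (ξ : S → 𝕜) (x : ι → S) : 𝕜 :=
  connectedSum (fun e => F (e.map x)) * ∏ i, ξ (x i)

theorem graphIntegrand_comp_equiv (e : κ ≃ ι) (x : ι → S) :
    graphIntegrand F ξ (x ∘ e) = graphIntegrand F ξ x := by
  rw [graphIntegrand, graphIntegrand, ← graphSum_comp_equiv e, ← e.prod_comp]
  simp only [Sym2.map_map, Function.comp_apply]

theorem connectedIntegrand_comp_equiv (e : κ ≃ ι) (x : ι → S) :
    connectedIntegrand F ξ (x ∘ e) = connectedIntegrand F ξ x := by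
  rw [connectedIntegrand, connectedIntegrand, ← connectedSum_comp_equiv e, ← e.prod_comp]
  simp only [Sym2.map_map, Function.comp_apply]

theorem graphIntegrand_eq_sum_component (F : Sym2 S → 𝕜) (ξ : S → 𝕜) (r : ι) (x : ι → S) :
    graphIntegrand F ξ x = ∑ s : Finset ι with r ∈ s,
      connectedIntegrand F ξ (fun i : {i // i ∈ s} => x i) *
        graphIntegrand F ξ (fun i : {i // i ∉ s} => x i) := by
  rw [graphIntegrand, graphSum_eq_sum_component _ r, Finset.sum_mul]
  refine Finset.sum_congr rfl fun s _ => ?_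
  have hprod : ∏ i, ξ (x i) = (∏ i : {i // i ∈ s}, ξ (x i)) * ∏ i : {i // i ∉ s}, ξ (x i) := by
    convert (Fintype.prod_subtype_mul_prod_subtype (· ∈ s) fun i => ξ (x i)).symm
  simp only [hprod, mul_mul_mul_comm, connectedIntegrand, graphIntegrand, Sym2.map_map]
  rfl

variable [MeasurableSpace S] {μ : Measure S}

/-- `n!` times the `n`-th coefficient of the partition function when `ι` has `n` elements; the
general index type allows cutting a configuration along a set of vertices. -/
noncomputable def graphIntegral (ι : Type*) [Fintype ι] [DecidableEq ι] (F : Sym2 S → 𝕜)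
    (μ : Measure S) (ξ : S → 𝕜) : 𝕜 :=
  ∫ x : ι → S, graphIntegrand F ξ x ∂Measure.pi fun _ => μ

/-- The analogue of `graphIntegral` over connected graphs: `n!` times the `n`-th coefficient of the
logarithm of the partition function when `ι` has `n` elements. -/
noncomputable def connectedIntegral (ι : Type*) [Fintype ι] [DecidableEq ι] (F : Sym2 S → 𝕜)
    (μ : Measure S) (ξ : S → 𝕜) : 𝕜 :=
  ∫ x : ι → S, connectedIntegrand F ξ x ∂Measure.pi fun _ => μ

theorem graphIntegral_fin_zero : graphIntegral (Fin 0) F μ ξ = 1 := by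
  simp [graphIntegral, graphIntegrand, graphSum_eq_graphWeight_top, graphWeight,
    Finset.eq_empty_of_isEmpty, measureReal_def]

theorem connectedIntegral_fin_zero : connectedIntegral (Fin 0) F μ ξ = 0 := by
  have not_connected : ∀ G : SimpleGraph (Fin 0), ¬ G.Connected := fun G hG =>
    hG.nonempty.elim (·.elim0)
  simp [connectedIntegral, connectedIntegrand, connectedSum, not_connected]

variable [SigmaFinite μ]

theorem graphIntegral_congr (e : κ ≃ ι) : graphIntegral κ F μ ξ = graphIntegral ι F μ ξ := by
  rw [graphIntegral, graphIntegral, ← integral_pi_comp_equiv μ e]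
  simp only [graphIntegrand_comp_equiv]

theorem connectedIntegral_congr (e : κ ≃ ι) :
    connectedIntegral κ F μ ξ = connectedIntegral ι F μ ξ := by
  rw [connectedIntegral, connectedIntegral, ← integral_pi_comp_equiv μ e]
  simp only [connectedIntegrand_comp_equiv]

variable (hF : Measurable fun p : S × S => F s(p.1, p.2)) {C : ℝ} (hFC : ∀ e, ‖F e‖ ≤ C)
  (hξ : Integrable ξ μ)
include hF hFC hξ

theorem integrable_graphIntegrand :
    Integrable (graphIntegrand F ξ : (ι → S) → 𝕜) (Measure.pi fun _ => μ) :=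
  integrable_sum_graphWeight hF hFC hξ _

theorem integrable_connectedIntegrand :
    Integrable (connectedIntegrand F ξ : (ι → S) → 𝕜) (Measure.pi fun _ => μ) :=
  integrable_sum_graphWeight hF hFC hξ _

theorem graphIntegral_eq_sum_component (r : ι) :
    graphIntegral ι F μ ξ = ∑ s : Finset ι with r ∈ s,
      connectedIntegral {i // i ∈ s} F μ ξ * graphIntegral {i // i ∉ s} F μ ξ := by
  simp only [graphIntegral, graphIntegrand_eq_sum_component F ξ r]
  rw [integral_finsetSum]
  · refine Finset.sum_congr rfl fun s _ => ?_
    rw [connectedIntegral, ← integral_prod_mul,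
      ← (measurePreserving_piEquivPiSubtypeProd_mem μ s).integral_comp']
    rfl
  · exact fun s _ => (measurePreserving_piEquivPiSubtypeProd_mem μ s).integrable_comp_of_integrable
      ((integrable_connectedIntegrand hF hFC hξ).mul_prod (integrable_graphIntegrand hF hFC hξ))

theorem graphIntegral_fin_succ (n : ℕ) :
    graphIntegral (Fin (n + 1)) F μ ξ = ∑ k ∈ Finset.range (n + 1), (n.choose k : 𝕜) *
      (connectedIntegral (Fin (k + 1)) F μ ξ * graphIntegral (Fin (n - k)) F μ ξ) := by
  have hterm : ∀ s : Finset (Fin (n + 1)),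
      connectedIntegral {i // i ∈ s} F μ ξ * graphIntegral {i // i ∉ s} F μ ξ =
        connectedIntegral (Fin s.card) F μ ξ * graphIntegral (Fin (n + 1 - s.card)) F μ ξ := by
    intro s
    rw [connectedIntegral_congr s.equivFin,
      graphIntegral_congr (Fintype.equivFinOfCardEq (n := n + 1 - s.card) (by simp))]
  rw [graphIntegral_eq_sum_component hF hFC hξ 0, Finset.sum_congr rfl fun s _ => hterm s,
    sum_card_of_mem 0 fun k =>
      connectedIntegral (Fin k) F μ ξ * graphIntegral (Fin (n + 1 - k)) F μ ξ]
  refine Finset.sum_congr (by simp) fun k _ => ?_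
  rw [Fintype.card_fin, Nat.add_sub_cancel, Nat.add_sub_add_right, nsmul_eq_mul]

theorem egf_connectedIntegral :
    egf (fun n => connectedIntegral (Fin n) F μ ξ) =
      PowerSeries.logOf (egf fun n => graphIntegral (Fin n) F μ ξ) :=
  egf_eq_logOf_egf graphIntegral_fin_zero connectedIntegral_fin_zero
    (graphIntegral_fin_succ hF hFC hξ)

end ClusterIntegral

section ProductMeasure

theorem measurable_finCons {n : ℕ} {X : Fin (n + 1) → Type*} [∀ i, MeasurableSpace (X i)] :
    Measurable fun p : X 0 × (∀ i : Fin n, X i.succ) => (Fin.cons p.1 p.2 : ∀ i, X i) := by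
  refine measurable_pi_lambda _ (Fin.cases ?_ fun j => ?_)
  · exact measurable_fst
  · exact (measurable_pi_apply j).comp measurable_snd

theorem measurePreserving_finCons {n : ℕ} {X : Fin (n + 1) → Type*} [∀ i, MeasurableSpace (X i)]
    (μ : ∀ i, Measure (X i)) [∀ i, SigmaFinite (μ i)] :
    MeasurePreserving (fun p : X 0 × (∀ i : Fin n, X i.succ) => (Fin.cons p.1 p.2 : ∀ i, X i))
      ((μ 0).prod (Measure.pi fun i => μ i.succ)) (Measure.pi μ) := by
  have coe_symm : ⇑(MeasurableEquiv.piFinSuccAbove X 0).symm =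
      fun p : X 0 × (∀ i : Fin n, X i.succ) => (Fin.cons p.1 p.2 : ∀ i, X i) :=
    congrArg DFunLike.coe (Fin.insertNthEquiv_zero X)
  exact coe_symm ▸ (measurePreserving_piFinSuccAbove μ 0).symm

theorem lintegral_pi_fin_succ {n : ℕ} {X : Fin (n + 1) → Type*} [∀ i, MeasurableSpace (X i)]
    (μ : ∀ i, Measure (X i)) [∀ i, SigmaFinite (μ i)] {g : (∀ i, X i) → ℝ≥0∞}
    (hg : Measurable g) :
    ∫⁻ x, g x ∂Measure.pi μ =
      ∫⁻ x, ∫⁻ y : ∀ i : Fin n, X i.succ, g (Fin.cons x y)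
        ∂(Measure.pi fun i => μ i.succ) ∂μ 0 := by
  rw [← (measurePreserving_finCons μ).lintegral_comp hg]
  exact lintegral_prod _ (hg.comp measurable_finCons).aemeasurable

theorem lintegral_fin_prod_eq_prod {n : ℕ} {X : Fin n → Type*} [∀ i, MeasurableSpace (X i)]
    (μ : ∀ i, Measure (X i)) [∀ i, SigmaFinite (μ i)] {f : ∀ i, X i → ℝ≥0∞}
    (hf : ∀ i, Measurable (f i)) :
    ∫⁻ x, ∏ i, f i (x i) ∂Measure.pi μ = ∏ i, ∫⁻ x, f i x ∂μ i := by
  induction n with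
  | zero => simp
  | succ n ih =>
    have measurable_prod : Measurable fun x : ∀ i, X i => ∏ i, f i (x i) :=
      Finset.measurable_prod _ fun i _ => (hf i).comp (measurable_pi_apply i)
    have measurable_tail : Measurable fun y : ∀ i : Fin n, X i.succ => ∏ i, f i.succ (y i) :=
      Finset.measurable_prod _ fun i _ => (hf _).comp (measurable_pi_apply i)
    rw [lintegral_pi_fin_succ μ measurable_prod]
    simp only [Fin.prod_univ_succ, Fin.cons_zero, Fin.cons_succ,
      lintegral_const_mul _ measurable_tail, ih _ fun i => hf i.succ, lintegral_mul_const _ (hf 0)]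

theorem lintegral_fintype_prod_eq_prod {ι : Type*} [Fintype ι] {X : ι → Type*}
    [∀ i, MeasurableSpace (X i)] (μ : ∀ i, Measure (X i)) [∀ i, SigmaFinite (μ i)]
    {f : ∀ i, X i → ℝ≥0∞} (hf : ∀ i, Measurable (f i)) :
    ∫⁻ x, ∏ i, f i (x i) ∂Measure.pi μ = ∏ i, ∫⁻ x, f i x ∂μ i := by
  let e := (Fintype.equivFin ι).symm
  rw [← (measurePreserving_piCongrLeft μ e).lintegral_comp_emb
    (MeasurableEquiv.measurableEmbedding _)]
  simp_rw [← e.prod_comp, MeasurableEquiv.coe_piCongrLeft, Equiv.piCongrLeft_apply_apply]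
  exact lintegral_fin_prod_eq_prod _ fun i => hf (e i)

theorem pi_withDensity {ι : Type*} [Fintype ι] {X : ι → Type*} [∀ i, MeasurableSpace (X i)]
    (μ : ∀ i, Measure (X i)) [∀ i, SigmaFinite (μ i)] {f : ∀ i, X i → ℝ≥0∞}
    (hf : ∀ i, Measurable (f i)) [∀ i, SigmaFinite ((μ i).withDensity (f i))] :
    Measure.pi (fun i => (μ i).withDensity (f i)) =
      (Measure.pi μ).withDensity fun x => ∏ i, f i (x i) := by
  refine Measure.pi_eq fun s hs => ?_
  rw [withDensity_apply _ (MeasurableSet.univ_pi hs), Measure.restrict_pi_pi,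
    lintegral_fintype_prod_eq_prod _ hf]
  exact Finset.prod_congr rfl fun i _ => (withDensity_apply _ (hs i)).symm

end ProductMeasure

section Partition

open PowerSeries

variable {S : Type*} {w : S → S → ℂ}

theorem norm_omega_le (hw_le : ∀ x y, ‖w x y‖ ≤ 1) {n : ℕ} (x : Fin n → S) : ‖omega w x‖ ≤ 1 := by
  rw [omega, norm_prod]
  exact Finset.prod_le_one (fun _ _ => norm_nonneg _) fun _ _ => hw_le _ _

theorem norm_mayer_le (hw_symm : ∀ x y, w x y = w y x) (hw_le : ∀ x y, ‖w x y‖ ≤ 1) (e : Sym2 S) :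
    ‖mayer w hw_symm e‖ ≤ 1 + 1 := by
  induction e with
  | h x y => exact norm_sub_le_of_le (hw_le x y) norm_one.le

theorem omegaT_fin_one (x : Fin 1 → S) : omegaT w x = 1 := by
  have connected (G : SimpleGraph (Fin 1)) : G.Connected :=
    (SimpleGraph.IsTree.of_subsingleton (G := G)).connected
  simp [omegaT, connected]

variable [MeasurableSpace S] {m : Measure S} {ξ : S → ℂ} {Λ : Set S}

theorem integrableOn_iff_absMeasure_lt_top (hξ : Measurable ξ) (hΛ : MeasurableSet Λ) :
    IntegrableOn ξ Λ m ↔ absMeasure m ξ Λ < ⊤ := by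
  rw [absMeasure, withDensity_apply _ hΛ]
  exact ⟨And.right, fun h => ⟨hξ.aestronglyMeasurable, h⟩⟩

section PartitionFunction

theorem IsLogPartition.unique {L L' : ℂ} (h : IsLogPartition w m ξ Λ L)
    (h' : IsLogPartition w m ξ Λ L') : L = L' := by
  obtain ⟨l, hl, hl₀, rfl, hexp⟩ := h
  obtain ⟨l', hl', hl'₀, rfl, hexp'⟩ := h'
  exact eqOn_of_exp_eq isPreconnected_Icc hl hl' (fun t ht => (hexp t ht).trans (hexp' t ht).symm)
    (Set.left_mem_Icc.2 zero_le_one) (hl₀.trans hl'₀.symm) (Set.right_mem_Icc.2 zero_le_one)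

theorem partitionTerm_zero : partitionTerm w m ξ Λ 0 = 1 := by
  simp [partitionTerm, omega, measureReal_def]

theorem constantCoeff_partitionSeries : constantCoeff (partitionSeries w m ξ Λ) = 1 := by
  simp [partitionSeries, partitionTerm_zero]

theorem coeff_zero_logPartitionSeries : coeff 0 (logPartitionSeries w m ξ Λ) = 0 := by
  rw [coeff_zero_eq_constantCoeff_apply]
  exact constantCoeff_logOf constantCoeff_partitionSeries

theorem partitionTerm_smul (n : ℕ) (t : ℂ) :
    partitionTerm w m (fun x => t * ξ x) Λ n = partitionTerm w m ξ Λ n * t ^ n := by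
  have hprod : ∀ x : Fin n → S,
      omega w x * ∏ i, t * ξ (x i) = omega w x * (∏ i, ξ (x i)) * t ^ n := fun x => by
    rw [Finset.prod_mul_distrib, Finset.prod_const, Finset.card_univ, Fintype.card_fin]
    ring
  simp only [partitionTerm, hprod, integral_mul_const]
  exact (mul_assoc _ _ _).symm

variable [SigmaFinite m]

theorem partitionTerm_eq_graphIntegral (hw_symm : ∀ x y, w x y = w y x) (n : ℕ) :
    partitionTerm w m ξ Λ n =
      (n ! : ℂ)⁻¹ * graphIntegral (Fin n) (mayer w hw_symm) (m.restrict Λ) ξ := by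
  simp only [partitionTerm, graphIntegral, graphIntegrand, Measure.restrict_pi_pi,
    omega_eq_graphSum hw_symm]

theorem logPartitionSeries_eq_egf (hw : Measurable (Function.uncurry w))
    (hw_symm : ∀ x y, w x y = w y x) (hw_le : ∀ x y, ‖w x y‖ ≤ 1) (hξ : IntegrableOn ξ Λ m) :
    logPartitionSeries w m ξ Λ =
      egf fun n => connectedIntegral (Fin n) (mayer w hw_symm) (m.restrict Λ) ξ := by
  rw [egf_connectedIntegral (hw.sub_const 1) (norm_mayer_le hw_symm hw_le) hξ, logPartitionSeries,
    partitionSeries, egf, funext (partitionTerm_eq_graphIntegral hw_symm)]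

variable (hw_le : ∀ x y, ‖w x y‖ ≤ 1) (hξ : IntegrableOn ξ Λ m)
include hw_le hξ

theorem summable_norm_coeff_partitionSeries :
    Summable fun n => ‖coeff n (partitionSeries w m ξ Λ)‖ := by
  refine .of_nonneg_of_le (fun _ => norm_nonneg _) (fun n => ?_)
    (Real.summable_pow_div_factorial (∫ x in Λ, ‖ξ x‖ ∂m))
  rw [partitionSeries, coeff_mk, partitionTerm, Measure.restrict_pi_pi, norm_mul, norm_inv,
    Complex.norm_natCast, div_eq_inv_mul]
  gcongr
  calc ‖∫ x : Fin n → S, omega w x * ∏ i, ξ (x i) ∂Measure.pi fun _ => m.restrict Λ‖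
      ≤ ∫ x : Fin n → S, ∏ i, ‖ξ (x i)‖ ∂Measure.pi fun _ => m.restrict Λ := by
        refine norm_integral_le_of_norm_le (.fintype_prod fun _ => hξ.norm) (.of_forall fun x => ?_)
        rw [norm_mul, norm_prod]
        exact mul_le_of_le_one_left (Finset.prod_nonneg fun _ _ => norm_nonneg _)
          (norm_omega_le hw_le x)
    _ = (∫ x in Λ, ‖ξ x‖ ∂m) ^ n := by
        rw [integral_fintype_prod_eq_pow fun x => ‖ξ x‖, Fintype.card_fin]

theorem partitionFunction_smul {t : ℂ} (ht : ‖t‖ ≤ 1) :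
    partitionFunction w m (fun x => t * ξ x) Λ = seriesSum (partitionSeries w m ξ Λ) t := by
  have hs : Summable fun n => coeff n (partitionSeries w m ξ Λ) * t ^ n :=
    .of_norm_bounded (summable_norm_coeff_partitionSeries hw_le hξ) (norm_coeff_mul_pow_le _ ht)
  rw [seriesSum, hs.tsum_eq_zero_add, partitionFunction]
  simp only [partitionSeries, coeff_mk, partitionTerm_smul, partitionTerm_zero, pow_zero, mul_one]

theorem isLogPartition_tsum (hc : Summable fun n => ‖coeff n (logPartitionSeries w m ξ Λ)‖) :
    IsLogPartition w m ξ Λ (∑' n, coeff n (logPartitionSeries w m ξ Λ)) := by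
  have norm_le_one : ∀ t ∈ Set.Icc (0 : ℝ) 1, ‖(t : ℂ)‖ ≤ 1 := fun t ht => by
    simpa [abs_of_nonneg ht.1] using ht.2
  refine ⟨fun t => seriesSum (logPartitionSeries w m ξ Λ) t, ?_, ?_, ?_, fun t ht => ?_⟩
  · exact (continuousOn_seriesSum hc).comp Complex.continuous_ofReal.continuousOn fun t ht =>
      mem_closedBall_zero_iff.2 (norm_le_one t ht)
  · simp only [Complex.ofReal_zero, seriesSum_zero_right, logPartitionSeries,
      constantCoeff_logOf constantCoeff_partitionSeries]
  · simp only [Complex.ofReal_one, seriesSum_one_right]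
  · rw [partitionFunction_smul hw_le hξ (norm_le_one t ht)]
    exact exp_seriesSum_logOf (summable_norm_coeff_partitionSeries hw_le hξ) hc
      constantCoeff_partitionSeries (norm_le_one t ht)

theorem IsLogPartition.enorm_le_tsum {L : ℂ} (hL : IsLogPartition w m ξ Λ L) :
    ‖L‖ₑ ≤ ∑' n, ‖coeff n (logPartitionSeries w m ξ Λ)‖ₑ := by
  by_cases hc : Summable fun n => ‖coeff n (logPartitionSeries w m ξ Λ)‖
  · rw [hL.unique (isLogPartition_tsum hw_le hξ hc)]
    exact enorm_tsum_le_tsum_enorm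
  · rw [not_ne_iff.1 (mt tsum_enorm_ne_top_iff_summable_norm.1 hc)]
    exact le_top

end PartitionFunction

section PinnedExpansion

theorem measurable_enorm_omegaT (hw : Measurable (Function.uncurry w)) (n : ℕ) :
    Measurable fun x : Fin n → S => ‖omegaT w x‖ₑ := by
  refine (Finset.measurable_sum _ fun G _ => Finset.measurable_prod _ fun p _ => ?_).enorm
  have hpair : Measurable fun x : Fin n → S => (x p.1, x p.2) :=
    (measurable_pi_apply p.1).prodMk (measurable_pi_apply p.2)
  exact (hw.comp hpair).sub_const 1

theorem absGammaTerm_zero (x : S) : absGammaTerm w m ξ 0 x = 1 := by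
  simp [absGammaTerm, omegaT_fin_one]

theorem absGamma_eq_tsum (x : S) : absGamma w m ξ x = ∑' n, absGammaTerm w m ξ n x := by
  rw [absGamma, tsum_eq_zero_add' (f := fun n => absGammaTerm w m ξ n x) ENNReal.summable,
    absGammaTerm_zero]

variable [SigmaFinite m]

theorem sigmaFinite_absMeasure (m : Measure S) [SigmaFinite m] (ξ : S → ℂ) :
    SigmaFinite (absMeasure m ξ) :=
  SigmaFinite.withDensity_of_ne_top (by simp)

theorem measurable_absGammaTerm (hw : Measurable (Function.uncurry w)) (n : ℕ) :
    Measurable (absGammaTerm w m ξ n) := by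
  have := sigmaFinite_absMeasure m ξ
  exact ((measurable_enorm_omegaT hw (n + 1)).comp
    measurable_finCons).lintegral_prod_right'.const_mul _

theorem lintegral_absGamma (hw : Measurable (Function.uncurry w)) (μ : Measure S) :
    ∫⁻ x, absGamma w m ξ x ∂μ = ∑' n, ∫⁻ x, absGammaTerm w m ξ n x ∂μ := by
  simp only [absGamma_eq_tsum]
  exact lintegral_tsum fun n => (measurable_absGammaTerm hw n).aemeasurable

theorem pi_absMeasure_restrict {ι : Type*} [Fintype ι] (hξ : Measurable ξ) (hΛ : MeasurableSet Λ) :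
    Measure.pi (fun _ : ι => (absMeasure m ξ).restrict Λ) =
      (Measure.pi fun _ => m.restrict Λ).withDensity fun x => ∏ i, ‖ξ (x i)‖ₑ := by
  have := sigmaFinite_absMeasure (m.restrict Λ) ξ
  rw [absMeasure, restrict_withDensity hΛ]
  exact pi_withDensity _ fun _ => hξ.enorm

theorem enorm_connectedIntegral_le (hw : Measurable (Function.uncurry w))
    (hw_symm : ∀ x y, w x y = w y x) (hξ : Measurable ξ) (hΛ : MeasurableSet Λ) (n : ℕ) :
    ‖connectedIntegral (Fin (n + 1)) (mayer w hw_symm) (m.restrict Λ) ξ‖ₑ ≤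
      ∫⁻ x in Λ, ∫⁻ y : Fin n → S, ‖omegaT w (Fin.cons x y : Fin (n + 1) → S)‖ₑ
        ∂(Measure.pi fun _ => absMeasure m ξ) ∂(absMeasure m ξ) := by
  have := sigmaFinite_absMeasure m ξ
  have measurable_omegaT := measurable_enorm_omegaT hw (n + 1)
  have measurable_prod : Measurable fun x : Fin (n + 1) → S => ∏ i, ‖ξ (x i)‖ₑ :=
    Finset.measurable_prod _ fun i _ => hξ.enorm.comp (measurable_pi_apply i)
  calc ‖connectedIntegral (Fin (n + 1)) (mayer w hw_symm) (m.restrict Λ) ξ‖ₑ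
      ≤ ∫⁻ x : Fin (n + 1) → S, ‖omegaT w x * ∏ i, ξ (x i)‖ₑ
          ∂(Measure.pi fun _ => m.restrict Λ) := by
        simp only [omegaT_eq_connectedSum hw_symm]
        exact enorm_integral_le_lintegral_enorm _
    _ = ∫⁻ x : Fin (n + 1) → S, ‖omegaT w x‖ₑ
          ∂(Measure.pi fun _ => (absMeasure m ξ).restrict Λ) := by
        rw [pi_absMeasure_restrict hξ hΛ,
          lintegral_withDensity_eq_lintegral_mul _ measurable_prod measurable_omegaT]
        simp only [enorm_mul, enorm_prod, mul_comm, Pi.mul_apply]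
    _ = ∫⁻ x in Λ, ∫⁻ y : Fin n → S, ‖omegaT w (Fin.cons x y : Fin (n + 1) → S)‖ₑ
          ∂(Measure.pi fun _ => (absMeasure m ξ).restrict Λ) ∂(absMeasure m ξ) :=
        lintegral_pi_fin_succ _ measurable_omegaT
    _ ≤ _ := by
        refine lintegral_mono fun x => ?_
        rw [← Measure.restrict_pi_pi]
        exact lintegral_mono' Measure.restrict_le_self le_rfl

variable (hw : Measurable (Function.uncurry w)) (hw_symm : ∀ x y, w x y = w y x)
  (hw_le : ∀ x y, ‖w x y‖ ≤ 1) (hξ : Measurable ξ) (hΛ : MeasurableSet Λ)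
  (hfin : absMeasure m ξ Λ < ⊤)
include hw hw_symm hw_le hξ hΛ hfin

theorem enorm_coeff_succ_logPartitionSeries_le (n : ℕ) :
    ‖coeff (n + 1) (logPartitionSeries w m ξ Λ)‖ₑ ≤
      ∫⁻ x in Λ, absGammaTerm w m ξ n x ∂(absMeasure m ξ) := by
  have hint := (integrableOn_iff_absMeasure_lt_top hξ hΛ).2 hfin
  simp only [absGammaTerm]
  rw [lintegral_const_mul' _ _ (ENNReal.inv_ne_top.2 (Nat.cast_ne_zero.2 n.factorial_ne_zero)),
    logPartitionSeries_eq_egf hw hw_symm hw_le hint, egf, coeff_mk, enorm_mul]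
  gcongr ?_ * ?_
  · have henorm : ‖((n + 1)! : ℂ)‖ₑ = ((n + 1)! : ℝ≥0∞) := by simp [enorm_eq_nnnorm]
    rw [enorm_inv (Nat.cast_ne_zero.2 (n + 1).factorial_ne_zero), henorm]
    gcongr
    exact n.le_succ
  · exact enorm_connectedIntegral_le hw hw_symm hξ hΛ n

theorem tsum_enorm_coeff_logPartitionSeries_le :
    ∑' n, ‖coeff n (logPartitionSeries w m ξ Λ)‖ₑ ≤
      ∫⁻ x in Λ, absGamma w m ξ x ∂(absMeasure m ξ) := by
  rw [lintegral_absGamma hw, tsum_eq_zero_add' ENNReal.summable, coeff_zero_logPartitionSeries,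
    enorm_zero, zero_add]
  exact ENNReal.tsum_le_tsum (enorm_coeff_succ_logPartitionSeries_le hw hw_symm hw_le hξ hΛ hfin)

end PinnedExpansion

end Partition

end ClusterExp

open MeasureTheory ClusterExp in
theorem mainTheorem2 {S : Type*} [MeasurableSpace S] (m : Measure S) [SigmaFinite m]
    (ξ : S → ℂ) (hξ : Measurable ξ)
    (w : S → S → ℂ) (hw : Measurable (Function.uncurry w))
    (hw_symm : ∀ x y, w x y = w y x) (hw_le : ∀ x y, ‖w x y‖ ≤ 1) :
    -- `|Γ|(ν)(x) ≤ 𝓑(ν)(x)`, term by term and as a bound in `[0,∞]`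
    (∀ x : S, (∀ n : ℕ, absGammaTerm w m ξ n x ≤ treeSumTerm w m ξ n x) ∧
      absGamma w m ξ x ≤ treeSum w m ξ x) ∧
    -- `|ln Ξ_Λ(ν)| ≤ ∫_Λ |Γ|(ν) d|ν|`
    ∀ Λ : Set S, MeasurableSet Λ → absMeasure m ξ Λ < ⊤ →
      -- term by term, as power series in `z` after replacing `ν` by `zν`
      (PowerSeries.coeff 0 (logPartitionSeries w m ξ Λ) = 0 ∧
        ∀ n : ℕ, ‖PowerSeries.coeff (n + 1) (logPartitionSeries w m ξ Λ)‖ₑ ≤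
          ∫⁻ x in Λ, absGammaTerm w m ξ n x ∂(absMeasure m ξ)) ∧
      -- as a bound between numbers
      (∀ L : ℂ, IsLogPartition w m ξ Λ L →
        ‖L‖ₑ ≤ ∫⁻ x in Λ, absGamma w m ξ x ∂(absMeasure m ξ)) ∧
      -- when the right-hand side is finite, `ln Ξ_Λ(ν)` exists and is the sum of its expansion
      (∫⁻ x in Λ, absGamma w m ξ x ∂(absMeasure m ξ) < ⊤ →
        ∃ L : ℂ, IsLogPartition w m ξ Λ L ∧
          HasSum (fun n => PowerSeries.coeff n (logPartitionSeries w m ξ Λ)) L) := by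
  have hterm : ∀ (x : S) (n : ℕ), absGammaTerm w m ξ n x ≤ treeSumTerm w m ξ n x := fun x n =>
    mul_le_mul_right (lintegral_mono fun y => enorm_omegaT_le_treeWeight hw_symm hw_le _) _
  refine ⟨fun x => ⟨hterm x, add_le_add_right (ENNReal.tsum_le_tsum fun n => hterm x (n + 1)) _⟩,
    fun Λ hΛ hfin => ?_⟩
  have hint := (integrableOn_iff_absMeasure_lt_top hξ hΛ).2 hfin
  have hle := tsum_enorm_coeff_logPartitionSeries_le hw hw_symm hw_le hξ hΛ hfin
  refine ⟨⟨coeff_zero_logPartitionSeries,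
    enorm_coeff_succ_logPartitionSeries_le hw hw_symm hw_le hξ hΛ hfin⟩,
    fun L hL => (hL.enorm_le_tsum hw_le hint).trans hle, fun hlt => ?_⟩
  have hc := tsum_enorm_ne_top_iff_summable_norm.1 (hle.trans_lt hlt).ne
  exact ⟨_, isLogPartition_tsum hw_le hint hc, hc.of_norm.hasSum⟩
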